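/- \textsc{bipass} is the following two-player game. A strip is a finite row of black and white stones. A move on a strip interchanges a black stone with a white stone lying (not necessarily adjacently) to its right; Left may do so only if there is no black stone strictly between the two, and Right may do so only if there is no white stone strictly between the two. A position is a disjunctive sum of finitely many strips: the player to move chooses one strip and moves on it. Play is under the normal-play convention (a player who cannot move loses). Two finite games $G$ and $H$ have the same value, $G\equiv H$, if for every finite game $X$ the sums $G+X$ and $H+X$ have the same outcome (Left wins, Right wins, the next player wins, or the previous player wins). Let $0=\{\,\mid\,\}$, $*=\{0\mid 0\}$ and $*2=\{0,*\mid 0,*\}$. \textbf{Theorem.} No \textsc{bipass} position has value $*2$: if $s_1,\dots,s_n$ ($n\ge 0$) are strips, then $s_1+\cdots+s_n\not\equiv *2$. -/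

import Mathlib

namespace Bipass

/-! ### Normal-play games -/

/-- Finite (short) partizan combinatorial games: a game is given by a finite family of Left options
and a finite family of Right options, and every line of play ends. -/
inductive Game : Type 1
  | mk (α β : Type) [Finite α] [Finite β] (L : α → Game) (R : β → Game) : Game

/-- The two players. -/
inductive Player
  | left
  | right

namespace Game

/-- `MoverWins G p`: under normal play (a player who cannot move loses), player `p` wins `G` when
`p` moves first. -/
def MoverWins : Game → Player → Prop
  | mk _ _ L _, .left => ∃ i, ¬ MoverWins (L i) .right
  | mk _ _ _ R, .right => ∃ j, ¬ MoverWins (R j) .left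

/-- The four outcome classes: Left wins, the next player wins, the previous player wins,
Right wins. -/
inductive Outcome
  | L
  | N
  | P
  | R

open Classical in
/-- The normal-play outcome of a game. -/
noncomputable def outcome (G : Game) : Outcome :=
  if G.MoverWins .left then
    if G.MoverWins .right then .N else .L
  else
    if G.MoverWins .right then .R else .P

/-- The recursion on the second summand in the definition of `add`: `f i` and `g j` are the maps
"add the `i`-th Left option (the `j`-th Right option) of the first summand". -/
def addAux {α β : Type} [Finite α] [Finite β] (f : α → Game → Game) (g : β → Game → Game) :
    Game → Game
  | mk γ δ L' R' =>
    mk (α ⊕ γ) (β ⊕ δ)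
      (Sum.elim (fun i => f i (mk γ δ L' R')) (fun k => addAux f g (L' k)))
      (Sum.elim (fun j => g j (mk γ δ L' R')) (fun l => addAux f g (R' l)))

/-- The disjunctive sum: the player to move moves in exactly one of the two components; see
`mk_add_mk` for the recursion that it satisfies. -/
def add : Game → Game → Game
  | mk _ _ L R => addAux (fun i => add (L i)) (fun j => add (R j))

instance : Add Game := ⟨add⟩

theorem mk_add_mk {α β γ δ : Type} [Finite α] [Finite β] [Finite γ] [Finite δ]
    (L : α → Game) (R : β → Game) (L' : γ → Game) (R' : δ → Game) :
    mk α β L R + mk γ δ L' R' =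
      mk (α ⊕ γ) (β ⊕ δ)
        (Sum.elim (fun i => L i + mk γ δ L' R') (fun k => mk α β L R + L' k))
        (Sum.elim (fun j => R j + mk γ δ L' R') (fun l => mk α β L R + R' l)) :=
  rfl

/-- Equality of game values: `G` and `H` have the same outcome in every disjunctive sum. -/
def Equivalent (G H : Game) : Prop :=
  ∀ X : Game, outcome (G + X) = outcome (H + X)

/-- The game `0 = { | }`. -/
def zero : Game := mk Empty Empty Empty.elim Empty.elim

/-- The nimber `* = {0 | 0}`. -/
def star : Game := mk Unit Unit (fun _ => zero) (fun _ => zero)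

/-- The nimber `*2 = {0, * | 0, *}`. -/
def starTwo : Game := mk Bool Bool (fun b => cond b star zero) (fun b => cond b star zero)

end Game

/-! ### The ruleset -/

/-- The stones; black stones are Left's and white stones are Right's. -/
inductive Stone
  | black
  | white

instance : Finite Stone :=
  Finite.of_surjective (fun b : Bool => cond b Stone.black Stone.white) fun
    | .black => ⟨true, rfl⟩
    | .white => ⟨false, rfl⟩

/-- A strip: a finite row of stones, read from left to right. -/
abbrev Strip := List Stone

open Stone in
/-- A Left move interchanges a black stone with a white stone to its right, provided that there is
no black stone between them. -/
def LeftMove (s t : Strip) : Prop :=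
  ∃ u m v : Strip, black ∉ m ∧
    s = u ++ black :: (m ++ white :: v) ∧ t = u ++ white :: (m ++ black :: v)

open Stone in
/-- A Right move interchanges a black stone with a white stone to its right, provided that there is
no white stone between them. -/
def RightMove (s t : Strip) : Prop :=
  ∃ u m v : Strip, white ∉ m ∧
    s = u ++ black :: (m ++ white :: v) ∧ t = u ++ white :: (m ++ black :: v)

/-- The sum, over all black stones of a strip, of the number of stones to the right of it; used only
to see that play ends. -/
def weight : Strip → ℕ
  | [] => 0
  | .black :: s => s.length + weight s
  | .white :: s => weight s

theorem weight_append_white_black (m v : Strip) :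
    weight (m ++ .black :: v) = weight (m ++ .white :: v) + v.length := by
  induction m with
  | nil => simp [weight]; omega
  | cons c m ih => cases c <;> (simp [weight, ih]; try omega)

theorem weight_swap (u m v : Strip) :
    weight (u ++ .white :: (m ++ .black :: v)) < weight (u ++ .black :: (m ++ .white :: v)) := by
  induction u with
  | nil => simp [weight, weight_append_white_black]; omega
  | cons c u ih => cases c <;> simp [weight] at ih ⊢ <;> omega

theorem LeftMove.weight_lt {s t : Strip} (h : LeftMove s t) : weight t < weight s := by
  obtain ⟨u, m, v, -, rfl, rfl⟩ := h
  exact weight_swap u m v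

theorem RightMove.weight_lt {s t : Strip} (h : RightMove s t) : weight t < weight s := by
  obtain ⟨u, m, v, -, rfl, rfl⟩ := h
  exact weight_swap u m v

instance (s : Strip) : Finite {t // LeftMove s t} := by
  refine Set.Finite.subset (List.finite_length_eq Stone s.length) ?_
  rintro t ⟨u, m, v, -, rfl, rfl⟩
  simp

instance (s : Strip) : Finite {t // RightMove s t} := by
  refine Set.Finite.subset (List.finite_length_eq Stone s.length) ?_
  rintro t ⟨u, m, v, -, rfl, rfl⟩
  simp

/-- The game played on a single strip. Stones that can no longer take part in any move (white stones
with no black stone to their left, black stones with no white stone to their right) are left in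
place; this does not change the moves. -/
def stripGame (s : Strip) : Game :=
  .mk {t // LeftMove s t} {t // RightMove s t}
    (fun t => stripGame t.1) (fun t => stripGame t.1)
termination_by weight s
decreasing_by
  · exact t.2.weight_lt
  · exact t.2.weight_lt

/-- The game of a position, a finite collection of strips: the disjunctive sum of its strips (the
empty collection gives `0`). -/
def positionGame (p : List Strip) : Game :=
  p.foldr (fun s G => stripGame s + G) Game.zero

end Bipass

/-!
A strip is the boundary path of a Young diagram whose rows are the black stones with a white stone
to their right and whose columns are the white stones with a black stone to their left. A Left move
shortens one row and a Right move shortens one column. A Right move therefore never creates a row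
and destroys at most one column, while in a strip with at least two rows Left can destroy the
shortest row and keep all columns.

Suppose that a position has at most as many rows as columns, and add `*n` with `n ≥ 2`. Left, moving
first, keeps destroying a row, so that after each reply of Right there are still at most as many
rows as columns, until every strip has at most one row. In such a thin position each Right move
destroys exactly one column while Left can destroy any number of columns of a strip, and so Left
wins moving second if the number of columns is even and `*n` has been replaced by `0`, or odd and
`*n` has been replaced by `*`. Left thus moves from `*n` to the nimber of the correct parity. If
Right moves on `*n` before that, there are fewer rows than columns at that moment; this stays so
until the position is thin, and then some strip has at least two columns, of which Left destroys one
or two to correct the parity.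

By symmetry, one of the players wins the sum with `*n` moving first, whereas `*n + *n` is a win for
the second player.
-/

namespace Bipass

/-! ### Options and nimbers -/

/-- The opponent of a player. -/
def Player.other : Player → Player
  | .left => .right
  | .right => .left

@[simp] theorem Player.other_other (P : Player) : P.other.other = P := by
  cases P <;> rfl

namespace Game

/-- The option relation: `IsOption P G H` says that player `P` can move from `G` to `H`. It lets
the two players be treated alike. -/
def IsOption : Player → Game → Game → Prop
  | .left, mk _ _ L _, H => ∃ i, L i = H
  | .right, mk _ _ _ R, H => ∃ j, R j = H

theorem moverWins_iff_exists_isOption {P : Player} {G : Game} :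
    G.MoverWins P ↔ ∃ H, IsOption P G H ∧ ¬ H.MoverWins P.other := by
  cases G
  cases P <;> simp [MoverWins, IsOption, Player.other]

theorem isOption_add {P : Player} {G K X : Game} :
    IsOption P (G + K) X ↔
      (∃ H, IsOption P G H ∧ H + K = X) ∨ ∃ H, IsOption P K H ∧ G + H = X := by
  cases G
  cases K
  cases P <;> simp [mk_add_mk, IsOption]

theorem moverWins_add {P : Player} {G K : Game} :
    (G + K).MoverWins P ↔
      (∃ H, IsOption P G H ∧ ¬ (H + K).MoverWins P.other) ∨
        ∃ H, IsOption P K H ∧ ¬ (G + H).MoverWins P.other := by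
  rw [moverWins_iff_exists_isOption]
  constructor
  · rintro ⟨X, hX, hw⟩
    rcases isOption_add.1 hX with ⟨H, hH, rfl⟩ | ⟨H, hH, rfl⟩
    exacts [.inl ⟨H, hH, hw⟩, .inr ⟨H, hH, hw⟩]
  · rintro (⟨H, hH, hw⟩ | ⟨H, hH, hw⟩)
    · exact ⟨_, isOption_add.2 (.inl ⟨H, hH, rfl⟩), hw⟩
    · exact ⟨_, isOption_add.2 (.inr ⟨H, hH, rfl⟩), hw⟩

theorem outcome_eq_P_iff {G : Game} : G.outcome = .P ↔ ∀ P, ¬ G.MoverWins P := by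
  unfold outcome
  constructor
  · intro h P
    cases P <;> split_ifs at h <;> assumption
  · intro h
    simp [h]

/-- The games of the form `*n = {*0, …, *(n-1) | *0, …, *(n-1)}`. This is a predicate because a game
carries the types that index its options: `0`, `*` and `*2` are indexed by unrelated types, and
options may be repeated. -/
def IsNimber (n : ℕ) (G : Game) : Prop :=
  ∀ P, (∀ k : Fin n, ∃ H, IsOption P G H ∧ IsNimber k H) ∧
    ∀ H, IsOption P G H → ∃ k : Fin n, IsNimber k H

theorem IsNimber.exists_isOption {n k : ℕ} {G : Game} (hG : IsNimber n G) (hk : k < n)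
    (P : Player) : ∃ H, IsOption P G H ∧ IsNimber k H := by
  rw [IsNimber] at hG
  exact (hG P).1 ⟨k, hk⟩

theorem IsNimber.exists_lt_of_isOption {P : Player} {n : ℕ} {G H : Game} (hG : IsNimber n G)
    (hH : IsOption P G H) : ∃ k < n, IsNimber k H := by
  rw [IsNimber] at hG
  obtain ⟨k, hk⟩ := (hG P).2 H hH
  exact ⟨k, k.isLt, hk⟩

theorem isNimber_zero : IsNimber 0 zero := by
  rw [IsNimber]
  rintro (_ | _) <;> simp [IsOption, zero]

theorem isNimber_star : IsNimber 1 star := by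
  rw [IsNimber]
  rintro (_ | _) <;> simp [IsOption, star, isNimber_zero]

theorem isNimber_starTwo : IsNimber 2 starTwo := by
  rw [IsNimber]
  rintro (_ | _) <;>
    simp [IsOption, starTwo, Fin.exists_fin_two, isNimber_zero, isNimber_star, or_imp, forall_and,
      forall_eq']

theorem IsNimber.not_moverWins_add {n : ℕ} {G K : Game} (hG : IsNimber n G) (hK : IsNimber n K)
    (P : Player) : ¬ (G + K).MoverWins P := by
  rw [moverWins_add]
  rintro (⟨H, hH, hw⟩ | ⟨H, hH, hw⟩)
  · obtain ⟨k, hk, hHk⟩ := hG.exists_lt_of_isOption hH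
    obtain ⟨K', hK', hKk⟩ := hK.exists_isOption hk P.other
    exact hw (moverWins_add.2 (.inr ⟨K', hK', hHk.not_moverWins_add hKk _⟩))
  · obtain ⟨k, hk, hHk⟩ := hK.exists_lt_of_isOption hH
    obtain ⟨G', hG', hGk⟩ := hG.exists_isOption hk P.other
    exact hw (moverWins_add.2 (.inl ⟨G', hG', hGk.not_moverWins_add hHk _⟩))
termination_by n

end Game

open Game

/-! ### Rows and columns of a strip -/

theorem exists_eq_append_cons_of_lt_count {α : Type*} [BEq α] [LawfulBEq α] {a : α} {l : List α}
    {d : ℕ} (h : d < l.count a) : ∃ u v, l = u ++ a :: v ∧ u.count a = d := by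
  induction l generalizing d with
  | nil => simp at h
  | cons b l ih =>
    by_cases hba : b = a
    · subst hba
      cases d with
      | zero => exact ⟨[], l, rfl, rfl⟩
      | succ d =>
        obtain ⟨u, v, rfl, hu⟩ := ih (d := d) (by simpa using h)
        exact ⟨b :: u, v, rfl, by simp [hu]⟩
    · obtain ⟨u, v, rfl, hu⟩ := ih (d := d) (by simpa [hba] using h)
      exact ⟨b :: u, v, rfl, by simp [hba, hu]⟩

theorem exists_eq_append_cons_notMem_right {α : Type*} [BEq α] [LawfulBEq α] {a : α} {l : List α}
    (h : a ∈ l) : ∃ u v, l = u ++ a :: v ∧ a ∉ v := by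
  have hpos := List.count_pos_iff.2 h
  obtain ⟨u, v, rfl, hu⟩ := exists_eq_append_cons_of_lt_count (Nat.sub_lt hpos one_pos)
  refine ⟨u, v, rfl, List.count_eq_zero.1 ?_⟩
  rw [List.count_append, List.count_cons_self] at hu
  omega

instance : DecidableEq Stone
  | .black, .black => isTrue rfl
  | .white, .white => isTrue rfl
  | .black, .white => isFalse nofun
  | .white, .black => isFalse nofun

/-- The other colour of a stone. -/
@[simp] def Stone.swap : Stone → Stone
  | .black => .white
  | .white => .black

theorem Stone.swap_involutive : Function.Involutive Stone.swap
  | .black | .white => rfl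

/-- The conjugate strip, reversed and with the colours exchanged. Conjugation transposes the Young
diagram and exchanges the roles of the two players. -/
def conjugate (s : Strip) : Strip := (s.map Stone.swap).reverse

section

open Stone

variable {s t u m v : Strip}

@[simp] theorem conjugate_conjugate (s : Strip) : conjugate (conjugate s) = s := by
  simp only [conjugate, List.map_reverse, List.reverse_reverse, List.map_map,
    swap_involutive.comp_self, List.map_id]

@[simp] theorem conjugate_append (s t : Strip) :
    conjugate (s ++ t) = conjugate t ++ conjugate s := by
  simp [conjugate]

@[simp] theorem conjugate_cons (c : Stone) (s : Strip) :
    conjugate (c :: s) = conjugate s ++ [c.swap] := by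
  simp [conjugate]

theorem count_swap_conjugate (c : Stone) (s : Strip) :
    (conjugate s).count c.swap = s.count c := by
  rw [conjugate, List.count_reverse,
    List.count_map_of_injective _ _ swap_involutive.injective]

@[simp] theorem count_white_conjugate (s : Strip) : (conjugate s).count white = s.count black :=
  count_swap_conjugate black s

@[simp] theorem black_mem_conjugate : black ∈ conjugate s ↔ white ∈ s := by
  rw [← List.count_pos_iff, ← List.count_pos_iff, ← count_swap_conjugate white, swap]

@[simp] theorem white_mem_conjugate : white ∈ conjugate s ↔ black ∈ s := by
  rw [← black_mem_conjugate, conjugate_conjugate]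

theorem LeftMove.rightMove_conjugate (h : LeftMove s t) :
    RightMove (conjugate s) (conjugate t) := by
  obtain ⟨u, m, v, hm, rfl, rfl⟩ := h
  exact ⟨conjugate v, conjugate m, conjugate u, white_mem_conjugate.not.2 hm,
    by simp, by simp⟩

/-- The number of columns of the Young diagram of a strip: its white stones with a black stone
somewhere to their left. -/
def columns : Strip → ℕ
  | [] => 0
  | .black :: s => s.count .white
  | .white :: s => columns s

/-- The number of rows of the Young diagram of a strip: its black stones with a white stone
somewhere to their right. -/
def rows (s : Strip) : ℕ := columns (conjugate s)

theorem rows_conjugate (s : Strip) : rows (conjugate s) = columns s := by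
  rw [rows, conjugate_conjugate]

theorem columns_le_count_white (s : Strip) : columns s ≤ s.count white := by
  induction s with
  | nil => rfl
  | cons c s ih =>
    cases c
    · simp [columns]
    · simpa [columns] using ih.trans (Nat.le_succ _)

theorem rows_le_count_black (s : Strip) : rows s ≤ s.count black := by
  simpa [rows] using columns_le_count_white (conjugate s)

theorem columns_append_of_black_notMem (hu : black ∉ u) (v : Strip) :
    columns (u ++ v) = columns v := by
  induction u with
  | nil => rfl
  | cons c u ih => cases c <;> simp_all [columns]

theorem columns_eq_zero_of_black_notMem (hs : black ∉ s) : columns s = 0 := by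
  simpa [columns] using columns_append_of_black_notMem hs []

theorem columns_append_black_cons (u v : Strip) :
    columns (u ++ black :: v) = columns u + v.count white := by
  induction u with
  | nil => simp [columns]
  | cons c u ih => cases c <;> simp [columns, ih]

theorem columns_append_of_black_mem (hu : black ∈ u) (v : Strip) :
    columns (u ++ v) = columns u + v.count white := by
  obtain ⟨a, b, rfl⟩ := List.append_of_mem hu
  simp [columns_append_black_cons, Nat.add_assoc]

theorem rows_append_white_cons (u v : Strip) :
    rows (u ++ white :: v) = u.count black + rows v := by
  simp [rows, columns_append_black_cons, Nat.add_comm]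

theorem columns_swap_of_black_mem (hu : black ∈ u) (m v : Strip) :
    columns (u ++ white :: (m ++ black :: v)) = columns (u ++ black :: (m ++ white :: v)) := by
  simp only [columns_append_of_black_mem hu, List.count_append, List.count_cons]
  simp [Nat.add_assoc]

theorem columns_swap_of_black_notMem (hu : black ∉ u) (m v : Strip) :
    columns (u ++ white :: (m ++ black :: v)) = columns m + v.count white := by
  rw [columns_append_of_black_notMem hu, columns, columns_append_black_cons]

theorem rows_swap_of_white_notMem (u m : Strip) (hv : white ∉ v) :
    rows (u ++ white :: (m ++ black :: v)) = u.count black + rows m := by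
  simpa [rows, Nat.add_comm] using
    columns_swap_of_black_notMem (black_mem_conjugate.not.2 hv) (conjugate m) (conjugate u)

theorem columns_swap_le (u m v : Strip) :
    columns (u ++ white :: (m ++ black :: v)) ≤ columns (u ++ black :: (m ++ white :: v)) := by
  by_cases hu : black ∈ u
  · exact (columns_swap_of_black_mem hu m v).le
  · rw [columns_swap_of_black_notMem hu, columns_append_black_cons]
    have := columns_le_count_white m
    rw [List.count_append, List.count_cons_self]
    omega

theorem rows_swap_le (u m v : Strip) :
    rows (u ++ white :: (m ++ black :: v)) ≤ rows (u ++ black :: (m ++ white :: v)) := by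
  simpa [rows] using columns_swap_le (conjugate v) (conjugate m) (conjugate u)

theorem rows_append_black_cons_append_white_cons (u m v : Strip) :
    rows (u ++ black :: (m ++ white :: v)) = u.count black + m.count black + 1 + rows v := by
  simpa [Nat.add_assoc] using rows_append_white_cons (u ++ black :: m) v

theorem RightMove.rows_le (h : RightMove s t) : rows t ≤ rows s := by
  obtain ⟨u, m, v, -, rfl, rfl⟩ := h
  exact rows_swap_le u m v

theorem columns_swap_add_one_of_black_notMem (hu : black ∉ u) (hm : white ∉ m) (v : Strip) :
    columns (u ++ white :: (m ++ black :: v)) + 1 =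
      columns (u ++ black :: (m ++ white :: v)) := by
  have hm' : columns m = 0 := by
    simpa [List.count_eq_zero_of_not_mem hm] using columns_le_count_white m
  rw [columns_swap_of_black_notMem hu, columns_append_black_cons,
    columns_eq_zero_of_black_notMem hu, hm']
  simp [List.count_eq_zero_of_not_mem hm]

theorem RightMove.columns_le (h : RightMove s t) : columns s ≤ columns t + 1 := by
  obtain ⟨u, m, v, hm, rfl, rfl⟩ := h
  by_cases hu : black ∈ u
  · exact (columns_swap_of_black_mem hu m v).ge.trans (Nat.le_succ _)
  · exact (columns_swap_add_one_of_black_notMem hu hm v).ge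

theorem RightMove.columns_add_one (h : RightMove s t) (hs : rows s ≤ 1) :
    columns t + 1 = columns s := by
  obtain ⟨u, m, v, hm, rfl, rfl⟩ := h
  have hu : black ∉ u := by
    rw [rows_append_black_cons_append_white_cons] at hs
    rw [← List.count_eq_zero]
    omega
  exact columns_swap_add_one_of_black_notMem hu hm v

theorem exists_eq_append_black_of_columns_pos (h : 0 < columns s) :
    ∃ u v, s = u ++ black :: v ∧ black ∉ u ∧ v.count white = columns s := by
  have hs : black ∈ s := by
    contrapose! h
    exact (columns_eq_zero_of_black_notMem h).le
  obtain ⟨u, v, rfl, hu⟩ := List.eq_append_cons_of_mem hs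
  exact ⟨u, v, rfl, hu, by simp [columns_append_black_cons, columns_eq_zero_of_black_notMem hu]⟩

theorem rows_pos_of_columns_pos (h : 0 < columns s) : 0 < rows s := by
  obtain ⟨u, x, rfl, -, hx⟩ := exists_eq_append_black_of_columns_pos h
  obtain ⟨m, v, rfl⟩ := List.append_of_mem (List.count_pos_iff.1 (hx ▸ h))
  rw [rows_append_black_cons_append_white_cons]
  omega

theorem exists_leftMove_of_two_le_rows (h : 2 ≤ rows s) :
    ∃ t, LeftMove s t ∧ rows t + 1 = rows s ∧ columns t = columns s := by
  have hs : white ∈ s := by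
    by_contra hs
    have : rows s = 0 := columns_eq_zero_of_black_notMem (black_mem_conjugate.not.2 hs)
    omega
  obtain ⟨x, v, rfl, hv⟩ := exists_eq_append_cons_notMem_right hs
  have hrv : rows v = 0 := columns_eq_zero_of_black_notMem (black_mem_conjugate.not.2 hv)
  rw [rows_append_white_cons, hrv] at h
  obtain ⟨u, m, rfl, hm⟩ :=
    exists_eq_append_cons_notMem_right (List.count_pos_iff.1 (by omega : 0 < x.count black))
  have hcm : m.count black = 0 := List.count_eq_zero.2 hm
  have hrm : rows m = 0 := Nat.le_zero.1 (hcm ▸ rows_le_count_black m)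
  have hu : black ∈ u := by
    rw [← List.count_pos_iff]
    rw [List.count_append, List.count_cons_self] at h
    omega
  rw [List.append_assoc, List.cons_append]
  refine ⟨_, ⟨u, m, v, hm, rfl, rfl⟩, ?_, columns_swap_of_black_mem hu m v⟩
  rw [rows_swap_of_white_notMem u m hv, rows_append_black_cons_append_white_cons, hrv, hrm, hcm]

theorem exists_leftMove_of_rows_le_one (h : rows s ≤ 1) {d : ℕ} (hd : 0 < d)
    (hds : d ≤ columns s) :
    ∃ t, LeftMove s t ∧ rows t ≤ 1 ∧ columns t + d = columns s := by
  obtain ⟨u, x, rfl, hu, hx⟩ := exists_eq_append_black_of_columns_pos (hd.trans_le hds)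
  obtain ⟨m, v, rfl, hmd⟩ :=
    exists_eq_append_cons_of_lt_count (a := white) (by omega : d - 1 < x.count white)
  have hm : black ∉ m := by
    rw [rows_append_black_cons_append_white_cons] at h
    rw [← List.count_eq_zero]
    omega
  refine ⟨_, ⟨u, m, v, hm, rfl, rfl⟩, (rows_swap_le u m v).trans h, ?_⟩
  rw [columns_swap_of_black_notMem hu, columns_eq_zero_of_black_notMem hm, ← hx,
    List.count_append, List.count_cons_self]
  omega

end

/-! ### The two players on a strip -/

/-- The moves of a player on a single strip. -/
def StripMove : Player → Strip → Strip → Prop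
  | .left => LeftMove
  | .right => RightMove

/-- The lines that a player shortens: rows for Left, columns for Right. -/
def lines : Player → Strip → ℕ
  | .left => rows
  | .right => columns

section

variable {P : Player} {s t : Strip}

theorem isOption_stripGame {X : Game} :
    IsOption P (stripGame s) X ↔ ∃ t, StripMove P s t ∧ stripGame t = X := by
  rw [stripGame]
  cases P <;> simp [IsOption, StripMove]

theorem StripMove.lines_le (h : StripMove P.other s t) : lines P t ≤ lines P s := by
  cases P
  · exact RightMove.rows_le h
  · simpa [lines, rows_conjugate] using (LeftMove.rightMove_conjugate h).rows_le

theorem StripMove.lines_other_le (h : StripMove P.other s t) :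
    lines P.other s ≤ lines P.other t + 1 := by
  cases P
  · exact RightMove.columns_le h
  · exact (LeftMove.rightMove_conjugate h).columns_le

theorem StripMove.lines_other_add_one (h : StripMove P.other s t) (hs : lines P s ≤ 1) :
    lines P.other t + 1 = lines P.other s := by
  cases P
  · exact RightMove.columns_add_one h hs
  · exact (LeftMove.rightMove_conjugate h).columns_add_one ((rows_conjugate s).trans_le hs)

theorem lines_pos_of_lines_other_pos (h : 0 < lines P.other s) : 0 < lines P s := by
  cases P
  · exact rows_pos_of_columns_pos h
  · simpa [lines, rows_conjugate] using rows_pos_of_columns_pos (s := conjugate s) h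

theorem exists_stripMove_of_two_le_lines (h : 2 ≤ lines P s) :
    ∃ t, StripMove P s t ∧ lines P t + 1 = lines P s ∧ lines P.other t = lines P.other s := by
  cases P
  · exact exists_leftMove_of_two_le_rows h
  · obtain ⟨t, ht, hrows, hcolumns⟩ :=
      exists_leftMove_of_two_le_rows (s := conjugate s) ((rows_conjugate s).symm ▸ h)
    refine ⟨conjugate t, by simpa [StripMove] using ht.rightMove_conjugate, ?_, ?_⟩
    · exact hrows.trans (rows_conjugate s)
    · exact (rows_conjugate t).trans hcolumns

theorem exists_stripMove_of_lines_le_one (h : lines P s ≤ 1) {d : ℕ} (hd : 0 < d)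
    (hds : d ≤ lines P.other s) :
    ∃ t, StripMove P s t ∧ lines P t ≤ 1 ∧ lines P.other t + d = lines P.other s := by
  cases P
  · exact exists_leftMove_of_rows_le_one h hd hds
  · obtain ⟨t, ht, hrows, hcolumns⟩ :=
      exists_leftMove_of_rows_le_one (s := conjugate s) ((rows_conjugate s).trans_le h) hd hds
    refine ⟨conjugate t, by simpa [StripMove] using ht.rightMove_conjugate, hrows, ?_⟩
    simpa [lines, Player.other, rows] using hcolumns

end

/-! ### Positions -/

/-- The moves of a player on a position: a move on exactly one of the strips. -/
def PosMove (P : Player) (p q : List Strip) : Prop :=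
  ∃ a s t b, StripMove P s t ∧ p = a ++ s :: b ∧ q = a ++ t :: b

/-- The number of lines of a player in all the strips of a position. -/
def totalLines (P : Player) (p : List Strip) : ℕ := (p.map (lines P)).sum

/-- A position is thin for a player if each strip has at most one line of that player. -/
def Thin (P : Player) (p : List Strip) : Prop := ∀ s ∈ p, lines P s ≤ 1

section

variable {P : Player} {p q : List Strip}

theorem isOption_positionGame {X : Game} :
    IsOption P (positionGame p) X ↔ ∃ q, PosMove P p q ∧ positionGame q = X := by
  induction p generalizing X with
  | nil => cases P <;> simp [positionGame, zero, IsOption, PosMove]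
  | cons s p ih =>
    change IsOption P (stripGame s + positionGame p) X ↔ _
    simp only [isOption_add, isOption_stripGame, ih]
    constructor
    · rintro (⟨_, ⟨t, ht, rfl⟩, rfl⟩ | ⟨_, ⟨_, ⟨a, s', t, b, ht, rfl, rfl⟩, rfl⟩, rfl⟩)
      · exact ⟨t :: p, ⟨[], s, t, p, ht, rfl, rfl⟩, rfl⟩
      · exact ⟨s :: (a ++ t :: b), ⟨s :: a, s', t, b, ht, rfl, rfl⟩, rfl⟩
    · rintro ⟨_, ⟨_ | ⟨c, a⟩, s', t, b, ht, hp, rfl⟩, rfl⟩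
      · obtain ⟨rfl, rfl⟩ := List.cons_eq_cons.1 hp
        exact .inl ⟨_, ⟨t, ht, rfl⟩, rfl⟩
      · obtain ⟨rfl, rfl⟩ := List.cons_eq_cons.1 hp
        exact .inr ⟨_, ⟨_, ⟨a, s', t, b, ht, rfl, rfl⟩, rfl⟩, rfl⟩

theorem moverWins_positionGame_add {G : Game} :
    (positionGame p + G).MoverWins P ↔
      (∃ q, PosMove P p q ∧ ¬ (positionGame q + G).MoverWins P.other) ∨
        ∃ H, IsOption P G H ∧ ¬ (positionGame p + H).MoverWins P.other := by
  rw [moverWins_add]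
  simp only [isOption_positionGame, exists_exists_and_eq_and]

theorem PosMove.totalLines_le (h : PosMove P.other p q) : totalLines P q ≤ totalLines P p := by
  obtain ⟨a, s, t, b, hst, rfl, rfl⟩ := h
  simpa [totalLines] using hst.lines_le

theorem PosMove.totalLines_other_le (h : PosMove P.other p q) :
    totalLines P.other p ≤ totalLines P.other q + 1 := by
  obtain ⟨a, s, t, b, hst, rfl, rfl⟩ := h
  have := hst.lines_other_le
  simp only [totalLines, List.map_append, List.map_cons, List.sum_append, List.sum_cons]
  omega

theorem Thin.of_posMove_other (hp : Thin P p) (h : PosMove P.other p q) : Thin P q := by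
  obtain ⟨a, s, t, b, hst, rfl, rfl⟩ := h
  simp only [Thin, List.forall_mem_append, List.forall_mem_cons] at hp ⊢
  exact ⟨hp.1, hst.lines_le.trans hp.2.1, hp.2.2⟩

theorem Thin.totalLines_other_add_one (hp : Thin P p) (h : PosMove P.other p q) :
    totalLines P.other q + 1 = totalLines P.other p := by
  obtain ⟨a, s, t, b, hst, rfl, rfl⟩ := h
  have := hst.lines_other_add_one (hp s (by simp))
  simp only [totalLines, List.map_append, List.map_cons, List.sum_append, List.sum_cons]
  omega

theorem exists_posMove_of_not_thin (hp : ¬ Thin P p) :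
    ∃ q, PosMove P p q ∧ totalLines P q + 1 = totalLines P p ∧
      totalLines P.other q = totalLines P.other p := by
  obtain ⟨s, hs, hlines⟩ : ∃ s ∈ p, 2 ≤ lines P s := by
    simpa [Thin, Nat.succ_le_iff] using hp
  obtain ⟨a, b, rfl⟩ := List.append_of_mem hs
  obtain ⟨t, hst, hP, hother⟩ := exists_stripMove_of_two_le_lines hlines
  refine ⟨a ++ t :: b, ⟨a, s, t, b, hst, rfl, rfl⟩, ?_, ?_⟩ <;>
    simp only [totalLines, List.map_append, List.map_cons, List.sum_append, List.sum_cons] <;>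
    omega

theorem Thin.exists_posMove (hp : Thin P p) {s : Strip} (hs : s ∈ p) {d : ℕ} (hd : 0 < d)
    (hds : d ≤ lines P.other s) :
    ∃ q, PosMove P p q ∧ Thin P q ∧ totalLines P.other q + d = totalLines P.other p := by
  obtain ⟨a, b, rfl⟩ := List.append_of_mem hs
  obtain ⟨t, hst, ht, hother⟩ := exists_stripMove_of_lines_le_one (hp s hs) hd hds
  refine ⟨a ++ t :: b, ⟨a, s, t, b, hst, rfl, rfl⟩, ?_, ?_⟩
  · simp only [Thin, List.forall_mem_append, List.forall_mem_cons] at hp ⊢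
    exact ⟨hp.1, ht, hp.2.2⟩
  · simp only [totalLines, List.map_append, List.map_cons, List.sum_append, List.sum_cons]
    omega

end

/-! ### Strategies -/

section

variable {P : Player}

mutual

theorem Thin.not_moverWins_other_add_of_even {p : List Strip} {n : ℕ} {G : Game}
    (hp : Thin P p) (hG : IsNimber n G) (hn : n ≤ 1)
    (heven : Even (totalLines P.other p + n)) : ¬ (positionGame p + G).MoverWins P.other := by
  rw [moverWins_positionGame_add, Player.other_other]
  rintro (⟨q, hpq, hw⟩ | ⟨H, hH, hw⟩)
  · have hlines := hp.totalLines_other_add_one hpq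
    exact hw ((hp.of_posMove_other hpq).moverWins_add_of_odd hG hn (by grind))
  · obtain ⟨k, hk, hHk⟩ := hG.exists_lt_of_isOption hH
    exact hw (hp.moverWins_add_of_odd hHk (by omega) (by grind))
termination_by totalLines P.other p + n

theorem Thin.moverWins_add_of_odd {p : List Strip} {n : ℕ} {G : Game}
    (hp : Thin P p) (hG : IsNimber n G) (hn : n ≤ 1)
    (hodd : Odd (totalLines P.other p + n)) : (positionGame p + G).MoverWins P := by
  rw [moverWins_positionGame_add]
  rcases Nat.eq_zero_or_pos n with rfl | hpos
  · obtain ⟨s, hs, hlines⟩ : ∃ s ∈ p, 0 < lines P.other s := by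
      simpa [totalLines, Nat.pos_iff_ne_zero, List.sum_eq_zero_iff] using hodd.pos
    obtain ⟨q, hpq, hq, hqp⟩ := hp.exists_posMove hs one_pos hlines
    exact .inl ⟨q, hpq, hq.not_moverWins_other_add_of_even hG hn (by grind)⟩
  · obtain ⟨H, hH, hH0⟩ := hG.exists_isOption hpos P
    exact .inr ⟨H, hH, hp.not_moverWins_other_add_of_even hH0 zero_le_one (by grind)⟩
termination_by totalLines P.other p + n

end

theorem Thin.moverWins_add_of_two_le {p : List Strip} {n : ℕ} {G : Game}
    (hp : Thin P p) (hG : IsNimber n G) (hn : 2 ≤ n) :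
    (positionGame p + G).MoverWins P := by
  have hk : totalLines P.other p % 2 < 2 := Nat.mod_lt _ two_pos
  obtain ⟨H, hH, hHk⟩ := hG.exists_isOption (hk.trans_le hn) P
  exact moverWins_positionGame_add.2 <| .inr
    ⟨H, hH, hp.not_moverWins_other_add_of_even hHk (Nat.le_of_lt_succ hk) (by grind)⟩

theorem exists_two_le_lines_other_of_totalLines_lt {p : List Strip}
    (h : totalLines P p < totalLines P.other p) :
    ∃ s ∈ p, 2 ≤ lines P.other s := by
  obtain ⟨s, hs, hlt⟩ : ∃ s ∈ p, lines P s < lines P.other s := by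
    contrapose! h
    exact List.sum_le_sum h
  have := lines_pos_of_lines_other_pos (P := P) (s := s) (by omega)
  exact ⟨s, hs, by omega⟩

theorem Thin.moverWins_add_of_totalLines_lt {p : List Strip} {n : ℕ} {G : Game}
    (hp : Thin P p) (hG : IsNimber n G) (h : totalLines P p < totalLines P.other p) :
    (positionGame p + G).MoverWins P := by
  rcases le_or_gt 2 n with hn | hn
  · exact hp.moverWins_add_of_two_le hG hn
  obtain ⟨s, hs, hlines⟩ := exists_two_le_lines_other_of_totalLines_lt h
  obtain ⟨d, hd, hd2, hparity⟩ : ∃ d, 0 < d ∧ d ≤ 2 ∧ Even (totalLines P.other p + n + d) := by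
    rcases Nat.even_or_odd (totalLines P.other p + n) with heven | hodd
    exacts [⟨2, by simp, le_rfl, heven.add even_two⟩, ⟨1, one_pos, by simp, hodd.add_one⟩]
  obtain ⟨q, hpq, hq, hqp⟩ := hp.exists_posMove hs hd (hd2.trans hlines)
  exact moverWins_positionGame_add.2 <| .inl
    ⟨q, hpq, hq.not_moverWins_other_add_of_even hG (Nat.le_of_lt_succ hn) (by grind)⟩

theorem moverWins_add_of_not_thin {p : List Strip} {G : Game} (hp : ¬ Thin P p)
    (hposition : ∀ r, totalLines P r < totalLines P p →
      totalLines P.other p ≤ totalLines P.other r + 1 → (positionGame r + G).MoverWins P)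
    (hoption : ∀ q H, totalLines P q < totalLines P p →
      totalLines P.other q = totalLines P.other p → IsOption P.other G H →
        (positionGame q + H).MoverWins P) :
    (positionGame p + G).MoverWins P := by
  obtain ⟨q, hpq, hP, hother⟩ := exists_posMove_of_not_thin hp
  refine moverWins_positionGame_add.2 (.inl ⟨q, hpq, ?_⟩)
  rw [moverWins_positionGame_add, Player.other_other]
  rintro (⟨r, hqr, hw⟩ | ⟨H, hH, hw⟩)
  · have hrP := hqr.totalLines_le
    have hrother := hqr.totalLines_other_le
    exact hw (hposition r (by omega) (by omega))
  · exact hw (hoption q H (by omega) hother hH)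

theorem moverWins_add_of_totalLines_lt {p : List Strip} {n : ℕ} {G : Game}
    (hG : IsNimber n G) (h : totalLines P p < totalLines P.other p) :
    (positionGame p + G).MoverWins P := by
  by_cases hp : Thin P p
  · exact hp.moverWins_add_of_totalLines_lt hG h
  · refine moverWins_add_of_not_thin hp (fun r hrP hrother => ?_) (fun q H hqP hqother hH => ?_)
    · exact moverWins_add_of_totalLines_lt hG (by omega)
    · obtain ⟨k, -, hHk⟩ := hG.exists_lt_of_isOption hH
      exact moverWins_add_of_totalLines_lt hHk (by omega)
termination_by totalLines P p

theorem moverWins_add_of_totalLines_le {p : List Strip} {n : ℕ} {G : Game}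
    (hG : IsNimber n G) (hn : 2 ≤ n) (h : totalLines P p ≤ totalLines P.other p) :
    (positionGame p + G).MoverWins P := by
  by_cases hp : Thin P p
  · exact hp.moverWins_add_of_two_le hG hn
  · refine moverWins_add_of_not_thin hp (fun r hrP hrother => ?_) (fun q H hqP hqother hH => ?_)
    · exact moverWins_add_of_totalLines_le hG hn (by omega)
    · obtain ⟨k, -, hHk⟩ := hG.exists_lt_of_isOption hH
      exact moverWins_add_of_totalLines_lt hHk (by omega)
termination_by totalLines P p

end

end Bipass

open Bipass Bipass.Game in
theorem mainTheorem5_general (p : List Strip) {n : ℕ} (hn : 2 ≤ n) {G : Game} (hG : IsNimber n G) :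
    ¬ Equivalent (positionGame p) G := by
  intro h
  have hP : (positionGame p + G).outcome = .P :=
    (h G).trans (outcome_eq_P_iff.2 (hG.not_moverWins_add hG))
  rw [outcome_eq_P_iff] at hP
  rcases le_total (totalLines .left p) (totalLines .right p) with hle | hle
  · exact hP .left (moverWins_add_of_totalLines_le hG hn hle)
  · exact hP .right (moverWins_add_of_totalLines_le hG hn hle)

theorem mainTheorem5 (p : List Bipass.Strip) :
    ¬ Bipass.Game.Equivalent (Bipass.positionGame p) Bipass.Game.starTwo :=
  mainTheorem5_general p le_rfl Bipass.Game.isNimber_starTwo
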